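/- Let $X$ be a compact Hausdorff space and let $T$ be a topological group acting continuously on the left of $X$; we call $(X,T)$ a flow. It is *minimal* if every orbit $Tx$ is dense in $X$. An *invariant probability measure* is a Borel probability measure $\mu$ on $X$ with $\mu(t^{-1}A)=\mu(A)$ for all $t\in T$ and all Borel sets $A\subset X$. Define relations on $X$ as follows. * $(x,y)\in RP$ (the regionally proximal relation) if there are nets $(x_i),(y_i)$ in $X$ and $(t_i)$ in $T$, with a common index set, and a point $z\in X$ such that $x_i\to x$, $y_i\to y$, $t_ix_i\to z$ and $t_iy_i\to z$. * $(x,y)\in V$ if there are a net $(t_i)$ in $T$ and a point $z\in X$ such that $t_ix\to z$ and $t_i^{-1}z\to y$. * $(x,y)\in D$ if there are nets $(a_i),(b_i)$ in $T$, with a common index set, such that $a_ix\to x$, $b_ix\to x$ and $b_i^{-1}a_ix\to y$. A flow $(Y,T)$ on a compact Hausdorff space $Y$ is *equicontinuous* if for every neighborhood $\alpha$ of the diagonal in $Y\times Y$ there is a neighborhood $\beta$ of the diagonal such that $(ty,ty')\in\alpha$ for all $(y,y')\in\beta$ and $t\in T$. The *equicontinuous structure relation* of $(X,T)$ is the smallest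 closed $T$-invariant equivalence relation $S$ on $X$ such that the quotient flow $(X/S,T)$ is equicontinuous. **Theorem.** Let $(X,T)$ be a flow as above. 1. $D\subset RP$. 2. If $(X,T)$ is minimal, then $V\subset D$. 3. If $(X,T)$ is minimal and has an invariant probability measure, then $D=RP$, and $D$ is the equicontinuous structure relation of $(X,T)$. 4. If $(X,T)$ is minimal, $X$ is metrizable and $(X,T)$ has an invariant probability measure, then $V=RP=D$. -/

import Mathlib

open Filter Topology MeasureTheory

namespace TopFlow

variable (T X : Type*) [Group T] [TopologicalSpace X] [MulAction T X]

/-- The regionally proximal relation `RP`: there are nets `x_i → x`, `y_i → y`, `t_i` and a point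
`z` with `t_i x_i → z` and `t_i y_i → z`. A net of triples `(t_i, x_i, y_i)` is represented by its
eventuality filter, a proper filter on `T × X × X`. -/
def regionallyProximal : Set (X × X) :=
  {p | ∃ (l : Filter (T × X × X)) (z : X), l.NeBot ∧
    Tendsto (fun q ↦ q.2.1) l (𝓝 p.1) ∧ Tendsto (fun q ↦ q.2.2) l (𝓝 p.2) ∧
    Tendsto (fun q ↦ q.1 • q.2.1) l (𝓝 z) ∧ Tendsto (fun q ↦ q.1 • q.2.2) l (𝓝 z)}

/-- The relation `V` of Veech: there are a point `z` and a net `t_i` in `T` (represented by a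
proper filter on `T`) with `t_i x → z` and `t_i⁻¹ z → y`. -/
def veechV : Set (X × X) :=
  {p | ∃ (l : Filter T) (z : X), l.NeBot ∧
    Tendsto (fun t ↦ t • p.1) l (𝓝 z) ∧ Tendsto (fun t ↦ t⁻¹ • z) l (𝓝 p.2)}

/-- The relation `D` of Veech: there are nets `a_i`, `b_i` in `T` with the same index set
(represented by a proper filter on `T × T`) with `a_i x → x`, `b_i x → x`, `b_i⁻¹ a_i x → y`. -/
def veechD : Set (X × X) :=
  {p | ∃ l : Filter (T × T), l.NeBot ∧
    Tendsto (fun q ↦ q.1 • p.1) l (𝓝 p.1) ∧ Tendsto (fun q ↦ q.2 • p.1) l (𝓝 p.1) ∧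
    Tendsto (fun q ↦ (q.2⁻¹ * q.1) • p.1) l (𝓝 p.2)}

/-- There is a `T`-invariant Borel probability measure on `X`. -/
def HasInvariantProbabilityMeasure : Prop :=
  letI : MeasurableSpace X := borel X
  ∃ μ : Measure X, IsProbabilityMeasure μ ∧ SMulInvariantMeasure T X μ

/-- Equicontinuity of a compact Hausdorff flow. The entourages of the unique uniformity of a
compact Hausdorff space are the neighborhoods of the diagonal. -/
def IsEquicontinuous : Prop :=
  ∀ α ∈ 𝓝ˢ (Set.diagonal X), ∃ β ∈ 𝓝ˢ (Set.diagonal X),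
    ∀ p ∈ β, ∀ t : T, (t • p.1, t • p.2) ∈ α

variable {T X} in
/-- The quotient of `X` by an invariant equivalence relation carries the quotient topology. -/
instance instTopologicalSpaceQuotient (S : SMulCon T X) : TopologicalSpace S.Quotient :=
  inferInstanceAs (TopologicalSpace (Quotient S.toSetoid))

variable {X}

/-- `R` is a closed `T`-invariant equivalence relation on `X` for which the quotient flow
`(X/R, T)`, with the quotient topology, is equicontinuous. -/
def HasEquicontinuousQuotient (R : Set (X × X)) : Prop :=
  IsClosed R ∧ ∃ S : SMulCon T X,
    R = {p | S.toSetoid p.1 p.2} ∧ IsEquicontinuous T S.Quotient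

/-- `R` is the equicontinuous structure relation: the smallest closed `T`-invariant equivalence
relation whose quotient flow is equicontinuous. -/
def IsEquicontinuousStructureRelation (R : Set (X × X)) : Prop :=
  IsLeast {R' : Set (X × X) | HasEquicontinuousQuotient T R'} R

end TopFlow

namespace TopFlow

/-! ### Nets, and the inclusions D ⊆ RP and V ⊆ D. -/

section Nets

variable {T X : Type*} [Group T] [TopologicalSpace X] [MulAction T X]

/-! Let E (`pseudometricCon`) be the relation of being at distance 0 for every continuous invariant
pseudometric. Then RP ⊆ E, the quotient by E is equicontinuous, and RP lies in every closed R with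
equicontinuous quotient. So everything reduces to E ⊆ D and, for metrizable X, E ⊆ V.

For open U let N(x) be the set of w such that some t moves both x and w into U (`jointVisits`). N is
equivariant, and by minimality its measure does not depend on x; hence μ(N(x) ∆ N(y)) is a
continuous invariant pseudometric. If (x, y) ∈ E, then N(x) = N(y) up to a null set. The open set
N(y) contains y and μ has full support, so N(x) meets every neighborhood of y. Taking U near x gives
D; taking U near arbitrary points z and applying Baire gives V. -/

theorem exists_filter_tendsto_of_mem_closure_range {A B : Type*} [TopologicalSpace B] {f : A → B}
    {b : B} (h : b ∈ closure (Set.range f)) : ∃ l : Filter A, l.NeBot ∧ Tendsto f l (𝓝 b) := by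
  refine ⟨comap f (𝓝 b), ?_, tendsto_comap⟩
  rw [comap_neBot_iff]
  intro t ht
  obtain ⟨_, hb, a, rfl⟩ := mem_closure_iff_nhds.1 h t ht
  exact ⟨a, hb⟩

theorem mem_veechD_of_forall_nhds {x y : X}
    (h : ∀ U ∈ 𝓝 x, ∀ W ∈ 𝓝 y, ∃ a b : T, a • x ∈ U ∧ b • x ∈ U ∧ (b⁻¹ * a) • x ∈ W) :
    (x, y) ∈ veechD T X := by
  obtain ⟨l, hl, hf⟩ := exists_filter_tendsto_of_mem_closure_range (b := (x, x, y))
    (f := fun q : T × T ↦ (q.1 • x, q.2 • x, (q.2⁻¹ * q.1) • x)) <| by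
      refine mem_closure_iff_nhds.2 fun s hs ↦ ?_
      rw [nhds_prod_eq, nhds_prod_eq] at hs
      obtain ⟨U, hU, s', hs', hs⟩ := mem_prod_iff.1 hs
      obtain ⟨U', hU', W, hW, hs'⟩ := mem_prod_iff.1 hs'
      obtain ⟨a, b, ha, hb, hab⟩ := h (U ∩ U') (inter_mem hU hU') W hW
      exact ⟨_, hs ⟨ha.1, hs' ⟨hb.2, hab⟩⟩, (a, b), rfl⟩
  exact ⟨l, hl, hf.fst_nhds, hf.snd_nhds.fst_nhds, hf.snd_nhds.snd_nhds⟩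

theorem mem_veechV_of_forall_nhds {x y z : X}
    (h : ∀ U ∈ 𝓝 z, ∀ W ∈ 𝓝 y, ∃ t : T, t • x ∈ U ∧ t⁻¹ • z ∈ W) : (x, y) ∈ veechV T X := by
  obtain ⟨l, hl, hf⟩ := exists_filter_tendsto_of_mem_closure_range (b := (z, y))
    (f := fun t : T ↦ (t • x, t⁻¹ • z)) <| by
      refine mem_closure_iff_nhds.2 fun s hs ↦ ?_
      rw [nhds_prod_eq] at hs
      obtain ⟨U, hU, W, hW, hs⟩ := mem_prod_iff.1 hs
      obtain ⟨t, ht, ht'⟩ := h U hU W hW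
      exact ⟨_, hs ⟨ht, ht'⟩, t, rfl⟩
  exact ⟨l, z, hl, hf.fst_nhds, hf.snd_nhds⟩

theorem veechD_subset_regionallyProximal : veechD T X ⊆ regionallyProximal T X := by
  rintro ⟨x, y⟩ ⟨l, hl, ha, hb, hab⟩
  refine ⟨l.map fun q ↦ (q.2, x, (q.2⁻¹ * q.1) • x), x, hl.map _, ?_, ?_, ?_, ?_⟩ <;>
    rw [tendsto_map'_iff]
  · exact tendsto_const_nhds
  · exact hab
  · exact hb
  · simpa [Function.comp_def, ← mul_smul] using ha

theorem veechV_subset_veechD [ContinuousConstSMul T X] [MulAction.IsMinimal T X] :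
    veechV T X ⊆ veechD T X := by
  rintro ⟨x, y⟩ ⟨l, z, hl, hx, hy⟩
  refine mem_veechD_of_forall_nhds fun U hU W hW ↦ ?_
  obtain ⟨s, hs⟩ := isOpen_interior.exists_smul_mem T z ⟨x, mem_interior_iff_mem_nhds.2 hU⟩
  have hs : ∀ᶠ w in 𝓝 z, s • w ∈ U :=
    (continuous_const_smul s).continuousAt.eventually (mem_interior_iff_mem_nhds.1 hs)
  -- Both elements come from the same net, `u` after `t`: it must bring `u • x` so close to `z` that
  -- `t⁻¹` sends it into `W`.
  obtain ⟨t, htU, htW⟩ := ((hx.eventually hs).and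
    (hy.eventually_mem (interior_mem_nhds.2 hW))).exists
  have htW' : ∀ᶠ w in 𝓝 z, t⁻¹ • w ∈ W :=
    (continuous_const_smul t⁻¹).continuousAt.eventually (mem_interior_iff_mem_nhds.1 htW)
  obtain ⟨u, huU, huW⟩ := ((hx.eventually hs).and (hx.eventually htW')).exists
  exact ⟨s * u, s * t, by rwa [mul_smul], by rwa [mul_smul], by simpa [mul_smul] using huW⟩

end Nets

/-! ### Invariant pseudometrics and equicontinuous quotients. -/

section Pseudometric

variable (T : Type*) {X : Type*} [Group T] [TopologicalSpace X] [MulAction T X]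

/-- Reduces joint continuity to one variable; a product of quotient maps need not be a quotient map,
so this is how continuity descends to the quotient. -/
theorem continuous_of_triangle_of_tendsto {Y : Type*} [TopologicalSpace Y] {d : Y → Y → ℝ}
    (comm : ∀ x y, d x y = d y x) (tri : ∀ x y z, d x z ≤ d x y + d y z)
    (near : ∀ x, Tendsto (fun y ↦ d y x) (𝓝 x) (𝓝 0)) :
    Continuous fun p : Y × Y ↦ d p.1 p.2 := by
  rw [continuous_iff_continuousAt]
  rintro ⟨x, y⟩
  rw [ContinuousAt, tendsto_iff_norm_sub_tendsto_zero]
  have h0 := ((near x).comp (continuous_fst.tendsto (x, y))).add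
    ((near y).comp (continuous_snd.tendsto (x, y)))
  rw [add_zero] at h0
  refine squeeze_zero (fun _ ↦ norm_nonneg _) (fun p ↦ ?_) h0
  rw [Real.norm_eq_abs, abs_sub_le_iff]
  have h1 := tri p.1 x p.2
  have h2 := tri x y p.2
  have h3 := tri x p.1 y
  have h4 := tri p.1 p.2 y
  rw [comm x p.1] at h3
  rw [comm y p.2] at h2
  simp only [Function.comp_apply]
  constructor <;> linarith

/-- A continuous pseudometric on `X` for which `T` acts by isometries. -/
structure IsInvariantPseudometric (d : X → X → ℝ) : Prop where
  continuous : Continuous fun p : X × X ↦ d p.1 p.2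
  nonneg : ∀ x y, 0 ≤ d x y
  self : ∀ x, d x x = 0
  comm : ∀ x y, d x y = d y x
  triangle : ∀ x y z, d x z ≤ d x y + d y z
  smul : ∀ (t : T) x y, d (t • x) (t • y) = d x y

variable {T}

theorem IsInvariantPseudometric.zero : IsInvariantPseudometric T (fun _ _ : X ↦ 0) :=
  ⟨continuous_const, by simp, by simp, by simp, by simp, by simp⟩

theorem IsInvariantPseudometric.add {d e : X → X → ℝ} (hd : IsInvariantPseudometric T d)
    (he : IsInvariantPseudometric T e) : IsInvariantPseudometric T (fun x y ↦ d x y + e x y) where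
  continuous := hd.continuous.add he.continuous
  nonneg x y := add_nonneg (hd.nonneg x y) (he.nonneg x y)
  self x := by simp [hd.self, he.self]
  comm x y := by rw [hd.comm, he.comm]
  triangle x y z := by linarith [hd.triangle x y z, he.triangle x y z]
  smul t x y := by rw [hd.smul, he.smul]

theorem IsInvariantPseudometric.congr {d : X → X → ℝ} (hd : IsInvariantPseudometric T d)
    {x x' y y' : X} (hx : d x x' = 0) (hy : d y y' = 0) : d x y = d x' y' := by
  have h1 := hd.triangle x x' y
  have h2 := hd.triangle x' y' y
  have h3 := hd.triangle x' x y'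
  have h4 := hd.triangle x y y'
  rw [hd.comm x' x] at h3
  rw [hd.comm y' y] at h2
  linarith

theorem IsInvariantPseudometric.eq_zero_of_mem_regionallyProximal {d : X → X → ℝ}
    (hd : IsInvariantPseudometric T d) {x y : X} (h : (x, y) ∈ regionallyProximal T X) :
    d x y = 0 := by
  obtain ⟨l, z, hl, hx, hy, hxz, hyz⟩ := h
  have h1 := (hd.continuous.tendsto (x, y)).comp (hx.prodMk_nhds hy)
  have h2 := (hd.continuous.tendsto (z, z)).comp (hxz.prodMk_nhds hyz)
  simp only [Function.comp_def, hd.smul, hd.self] at h1 h2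
  exact tendsto_nhds_unique h1 h2

variable (T X)

/-- The relation of not being separated by any continuous invariant pseudometric. -/
def pseudometricCon : SMulCon T X where
  r x y := ∀ d : X → X → ℝ, IsInvariantPseudometric T d → d x y = 0
  iseqv :=
    { refl := fun x _ hd ↦ hd.self x
      symm := fun h d hd ↦ (hd.comm _ _).trans (h d hd)
      trans := fun {x y z} hxy hyz d hd ↦ le_antisymm
        (by linarith [hd.triangle x y z, hxy d hd, hyz d hd]) (hd.nonneg _ _) }
  smul t _ _ h d hd := (hd.smul t _ _).trans (h d hd)

theorem regionallyProximal_subset_pseudometricCon :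
    regionallyProximal T X ⊆ {p : X × X | (pseudometricCon T X).toSetoid p.1 p.2} :=
  fun _ hp _ hd ↦ hd.eq_zero_of_mem_regionallyProximal hp

theorem isClosed_pseudometricCon :
    IsClosed {p : X × X | (pseudometricCon T X).toSetoid p.1 p.2} := by
  have : {p : X × X | (pseudometricCon T X).toSetoid p.1 p.2} =
      ⋂ (d : X → X → ℝ) (_ : IsInvariantPseudometric T d), {p | d p.1 p.2 = 0} := by
    ext p
    simp only [Set.mem_iInter]
    rfl
  rw [this]
  exact isClosed_iInter fun d ↦ isClosed_iInter fun hd ↦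
    isClosed_eq hd.continuous continuous_const

variable {T X}

/-- The function induced by an invariant pseudometric on the quotient by `pseudometricCon`. -/
def IsInvariantPseudometric.quotient {d : X → X → ℝ} (hd : IsInvariantPseudometric T d) :
    (pseudometricCon T X).Quotient → (pseudometricCon T X).Quotient → ℝ :=
  Quotient.lift₂ d fun _ _ _ _ hx hy ↦ hd.congr (hx d hd) (hy d hd)

theorem IsInvariantPseudometric.isInvariantPseudometric_quotient
    {d : X → X → ℝ} (hd : IsInvariantPseudometric T d) :
    IsInvariantPseudometric T hd.quotient where
  continuous := by
    refine continuous_of_triangle_of_tendsto ?_ ?_ ?_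
    · rintro ⟨x⟩ ⟨y⟩; exact hd.comm x y
    · rintro ⟨x⟩ ⟨y⟩ ⟨z⟩; exact hd.triangle x y z
    · rintro ⟨x⟩
      have hc : Continuous fun q ↦ hd.quotient q (Quotient.mk _ x) :=
        continuous_quot_lift _ (hd.continuous.comp (Continuous.prodMk_left x))
      exact (hc.tendsto _).trans_eq (congrArg 𝓝 (hd.self x))
  nonneg := by rintro ⟨x⟩ ⟨y⟩; exact hd.nonneg x y
  self := by rintro ⟨x⟩; exact hd.self x
  comm := by rintro ⟨x⟩ ⟨y⟩; exact hd.comm x y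
  triangle := by rintro ⟨x⟩ ⟨y⟩ ⟨z⟩; exact hd.triangle x y z
  smul := by rintro t ⟨x⟩ ⟨y⟩; exact hd.smul t x y

theorem exists_isInvariantPseudometric_pos_of_isCompact {K : Set (X × X)} (hK : IsCompact K)
    (h : ∀ p ∈ K, ∃ d : X → X → ℝ, IsInvariantPseudometric T d ∧ d p.1 p.2 ≠ 0) :
    ∃ d : X → X → ℝ, IsInvariantPseudometric T d ∧ ∀ p ∈ K, 0 < d p.1 p.2 := by
  refine hK.induction_on (p := fun s ↦
    ∃ d : X → X → ℝ, IsInvariantPseudometric T d ∧ ∀ p ∈ s, 0 < d p.1 p.2) ?_ ?_ ?_ ?_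
  · exact ⟨_, .zero, by simp⟩
  · rintro s t hst ⟨d, hd, ht⟩
    exact ⟨d, hd, fun p hp ↦ ht p (hst hp)⟩
  · rintro s t ⟨d, hd, hs⟩ ⟨e, he, ht⟩
    refine ⟨_, hd.add he, fun p hp ↦ ?_⟩
    rcases hp with hp | hp
    · linarith [hs p hp, he.nonneg p.1 p.2]
    · linarith [ht p hp, hd.nonneg p.1 p.2]
  · intro p hp
    obtain ⟨d, hd, hdp⟩ := h p hp
    exact ⟨_, mem_nhdsWithin_of_mem_nhds <| (isOpen_lt continuous_const hd.continuous).mem_nhds <|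
      (hd.nonneg _ _).lt_of_ne' hdp, d, hd, fun _ h ↦ h⟩

theorem isEquicontinuous_of_forall_exists_pseudometric [CompactSpace X]
    (h : ∀ x y : X, x ≠ y → ∃ d : X → X → ℝ, IsInvariantPseudometric T d ∧ d x y ≠ 0) :
    IsEquicontinuous T X := by
  intro α hα
  obtain ⟨O, hO, hdO, hOα⟩ := mem_nhdsSet_iff_exists.1 hα
  obtain ⟨d, hd, hpos⟩ := exists_isInvariantPseudometric_pos_of_isCompact
    hO.isClosed_compl.isCompact fun p hp ↦ h p.1 p.2 fun he ↦ hp (hdO he)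
  obtain ⟨ε, hε, hεd⟩ : ∃ ε > 0, ∀ p ∈ Oᶜ, ε ≤ d p.1 p.2 := by
    rcases (Oᶜ).eq_empty_or_nonempty with he | hne
    · exact ⟨1, one_pos, by simp [he]⟩
    · obtain ⟨p, hp, hmin⟩ :=
        hO.isClosed_compl.isCompact.exists_isMinOn hne hd.continuous.continuousOn
      exact ⟨_, hpos p hp, fun q hq ↦ hmin hq⟩
  refine ⟨{p | d p.1 p.2 < ε}, ?_, fun p hp t ↦ hOα ?_⟩
  · refine (isOpen_lt hd.continuous continuous_const).mem_nhdsSet.2 fun p hp ↦ ?_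
    rw [Set.mem_diagonal_iff] at hp
    simpa [hp, hd.self] using hε
  · by_contra hc
    have := hεd _ hc
    rw [hd.smul] at this
    exact absurd hp (not_lt.2 this)

theorem isEquicontinuous_pseudometricCon_quotient [CompactSpace X] [T2Space X] :
    IsEquicontinuous T (pseudometricCon T X).Quotient := by
  have : CompactSpace (pseudometricCon T X).Quotient :=
    inferInstanceAs (CompactSpace (Quotient (pseudometricCon T X).toSetoid))
  refine isEquicontinuous_of_forall_exists_pseudometric ?_
  rintro ⟨x⟩ ⟨y⟩ hxy
  by_contra! hc
  exact hxy (Quotient.sound fun d hd ↦ hc _ hd.isInvariantPseudometric_quotient)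

/-- A pair outside `R` has a closed product neighborhood `C ×ˢ D` missing `R`, so the images of `C`
and `D` are closed and disjoint. Equicontinuity forbids pulling pairs near `(z, z)` back into them
by `t⁻¹`. -/
theorem regionallyProximal_subset_of_hasEquicontinuousQuotient [CompactSpace X] [T2Space X]
    {R : Set (X × X)} (hR : HasEquicontinuousQuotient T R) : regionallyProximal T X ⊆ R := by
  obtain ⟨hc, S, rfl, hS⟩ := hR
  rintro ⟨x, y⟩ ⟨l, z, hl, hx, hy, hxz, hyz⟩
  by_contra hxy
  have hn := hc.isOpen_compl.mem_nhds hxy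
  rw [nhds_prod_eq, ((closed_nhds_basis x).prod (closed_nhds_basis y)).mem_iff] at hn
  obtain ⟨⟨C, D⟩, ⟨⟨hCx, hC⟩, hDy, hD⟩, hCD⟩ := hn
  let π : X → S.Quotient := Quotient.mk _
  have hπ : Continuous π := continuous_quot_mk
  -- The saturation of a closed set is the projection of a compact set.
  have hsat {C : Set X} (hC : IsClosed C) : IsClosed (π '' C) := by
    have h : π ⁻¹' (π '' C) =
        Prod.snd '' ({p : X × X | S.toSetoid p.1 p.2} ∩ Prod.fst ⁻¹' C) := by
      ext w
      constructor
      · rintro ⟨v, hv, hvw⟩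
        exact ⟨(v, w), ⟨Quotient.exact hvw, hv⟩, rfl⟩
      · rintro ⟨⟨v, w⟩, ⟨hvw, hv⟩, rfl⟩
        exact ⟨v, hv, Quotient.sound hvw⟩
    refine isQuotientMap_quot_mk.isClosed_preimage.1 ?_
    exact h ▸ ((hc.inter (hC.preimage continuous_fst)).isCompact.image continuous_snd).isClosed
  have hα : ((π '' C) ×ˢ (π '' D))ᶜ ∈ 𝓝ˢ (Set.diagonal S.Quotient) := by
    refine ((hsat hC).prod (hsat hD)).isOpen_compl.mem_nhdsSet.2 ?_
    rintro p (hp : p.1 = p.2) ⟨⟨v, hv, hvp⟩, w, hw, hwp⟩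
    exact hCD (Set.mk_mem_prod hv hw) (Quotient.exact (hvp.trans (hp.trans hwp.symm)))
  obtain ⟨β, hβ, hβα⟩ := hS _ hα
  have hβz : ∀ᶠ p in 𝓝 (z, z), (π p.1, π p.2) ∈ β :=
    (hπ.prodMap hπ).continuousAt.eventually (mem_nhdsSet_iff_forall.1 hβ (π z, π z) rfl)
  obtain ⟨⟨t, v, w⟩, ⟨hv, hw⟩, hvw⟩ := (((hx.eventually_mem hCx).and (hy.eventually_mem hDy)).and
    ((hxz.prodMk_nhds hyz).eventually hβz)).exists
  refine hβα _ hvw t⁻¹ ⟨⟨v, hv, ?_⟩, w, hw, ?_⟩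
  · exact congrArg π (inv_smul_smul t v).symm
  · exact congrArg π (inv_smul_smul t w).symm

end Pseudometric

/-! ### The pseudometric built from joint visits. -/

section Measure

variable {T X : Type*} [Group T] [TopologicalSpace X] [MulAction T X]

variable (T) in
/-- The points `w` for which some `t` moves both `x` and `w` into `U`. -/
def jointVisits (U : Set X) (x : X) : Set X := {w | ∃ t : T, t • x ∈ U ∧ t • w ∈ U}

theorem isOpen_jointVisits [ContinuousConstSMul T X] {U : Set X} (hU : IsOpen U) :
    IsOpen {p : X × X | p.2 ∈ jointVisits T U p.1} := by
  have : {p : X × X | p.2 ∈ jointVisits T U p.1} = ⋃ t : T, {p | t • p.1 ∈ U ∧ t • p.2 ∈ U} := by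
    ext p; simp [jointVisits]
  rw [this]
  exact isOpen_iUnion fun t ↦ (hU.preimage (continuous_fst.const_smul t)).inter
    (hU.preimage (continuous_snd.const_smul t))

theorem isOpen_jointVisits_left [ContinuousConstSMul T X] {U : Set X} (hU : IsOpen U) (x : X) :
    IsOpen (jointVisits T U x) :=
  (isOpen_jointVisits hU).preimage (Continuous.prodMk_right x)

omit [TopologicalSpace X] in
theorem jointVisits_smul (U : Set X) (s : T) (x : X) :
    jointVisits T U (s • x) = (fun w ↦ s⁻¹ • w) ⁻¹' jointVisits T U x := by
  ext w
  constructor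
  · rintro ⟨t, h1, h2⟩
    exact ⟨t * s, by rwa [mul_smul], by simpa [mul_smul] using h2⟩
  · rintro ⟨t, h1, h2⟩
    exact ⟨t * s⁻¹, by simpa [mul_smul] using h1, by rwa [mul_smul]⟩

theorem self_mem_jointVisits [MulAction.IsMinimal T X] {U : Set X} (hU : IsOpen U)
    (hne : U.Nonempty) (x : X) : x ∈ jointVisits T U x := by
  obtain ⟨t, ht⟩ := hU.exists_smul_mem T x hne
  exact ⟨t, ht, ht⟩

variable [ContinuousConstSMul T X] [MeasurableSpace X] [BorelSpace X]
  (μ : Measure X) [IsFiniteMeasure μ] [SMulInvariantMeasure T X μ]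

omit [TopologicalSpace X] [ContinuousConstSMul T X] [BorelSpace X] [IsFiniteMeasure μ] in
theorem measureReal_jointVisits_smul (U : Set X) (s : T) (x : X) :
    μ.real (jointVisits T U (s • x)) = μ.real (jointVisits T U x) := by
  rw [jointVisits_smul, measureReal_def, measure_preimage_smul, measureReal_def]

omit [SMulInvariantMeasure T X μ] in
-- Lower semicontinuity in measure: inner regularity supplies a compact `K`, and the tube lemma
-- keeps it inside the sets of nearby points.
theorem exists_subset_jointVisits [T2Space X] [μ.Regular] {U : Set X} (hU : IsOpen U) (x : X) {ε : ℝ}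
    (hε : 0 < ε) : ∃ K : Set X, MeasurableSet K ∧ μ.real (jointVisits T U x) - ε < μ.real K ∧
      ∀ᶠ y in 𝓝 x, K ⊆ jointVisits T U y := by
  obtain ⟨K, hKU, hK, hlt⟩ : ∃ K ⊆ jointVisits T U x, IsCompact K ∧
      μ.real (jointVisits T U x) - ε < μ.real K := by
    rcases lt_or_ge (μ.real (jointVisits T U x) - ε) 0 with h | h
    · exact ⟨∅, Set.empty_subset _, isCompact_empty, by simpa using h⟩
    · obtain ⟨K, hKU, hK, hlt⟩ := (isOpen_jointVisits_left hU x).exists_lt_isCompact (μ := μ)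
        (r := ENNReal.ofReal (μ.real (jointVisits T U x) - ε)) <| by
          rw [ENNReal.ofReal_lt_iff_lt_toReal h (measure_ne_top _ _), ← measureReal_def]
          linarith
      exact ⟨K, hKU, hK, (ENNReal.ofReal_lt_iff_lt_toReal h (measure_ne_top _ _)).1 hlt⟩
  obtain ⟨A, B, hA, -, hxA, hKB, hAB⟩ := generalized_tube_lemma (isCompact_singleton (x := x)) hK
    (isOpen_jointVisits (T := T) hU) (by rintro ⟨a, w⟩ ⟨rfl, hw⟩; exact hKU hw)
  refine ⟨K, hK.measurableSet, hlt, ?_⟩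
  filter_upwards [hA.mem_nhds (hxA rfl)] with y hy w hw
  exact hAB (Set.mk_mem_prod hy (hKB hw))

/-- The measure is lower semicontinuous and constant along orbits, which are dense. -/
theorem measureReal_jointVisits_eq [T2Space X] [μ.Regular] [MulAction.IsMinimal T X] {U : Set X}
    (hU : IsOpen U) (x y : X) :
    μ.real (jointVisits T U x) = μ.real (jointVisits T U y) := by
  suffices h : ∀ x y, μ.real (jointVisits T U x) ≤ μ.real (jointVisits T U y) from
    le_antisymm (h x y) (h y x)
  intro x y
  refine le_of_forall_pos_lt_add fun ε hε ↦ ?_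
  obtain ⟨K, -, hK, hx⟩ := exists_subset_jointVisits (T := T) μ hU x hε
  obtain ⟨t, ht⟩ := isOpen_interior.exists_smul_mem T y ⟨x, mem_interior_iff_mem_nhds.2 hx⟩
  have := measureReal_mono (μ := μ) (interior_subset ht)
  rw [measureReal_jointVisits_smul μ U] at this
  linarith

theorem isInvariantPseudometric_jointVisits [T2Space X] [μ.Regular] [MulAction.IsMinimal T X]
    {U : Set X} (hU : IsOpen U) : IsInvariantPseudometric T
      fun x y ↦ μ.real (symmDiff (jointVisits T U x) (jointVisits T U y)) := by
  have hm (x : X) : MeasurableSet (jointVisits T U x) := (isOpen_jointVisits_left hU x).measurableSet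
  have tri (x y z : X) : μ.real (symmDiff (jointVisits T U x) (jointVisits T U z)) ≤
      μ.real (symmDiff (jointVisits T U x) (jointVisits T U y)) +
      μ.real (symmDiff (jointVisits T U y) (jointVisits T U z)) :=
    measureReal_symmDiff_le _
  have near (x : X) : Tendsto (fun y ↦ μ.real (symmDiff (jointVisits T U y) (jointVisits T U x)))
      (𝓝 x) (𝓝 0) := by
    rw [tendsto_order]
    refine ⟨fun a ha ↦ .of_forall fun y ↦ ha.trans_le measureReal_nonneg, fun ε hε ↦ ?_⟩
    obtain ⟨K, hKm, hK, hx⟩ := exists_subset_jointVisits (T := T) μ hU x (half_pos hε)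
    filter_upwards [hx] with y hy
    -- Constancy of the measure upgrades lower semicontinuity to continuity: both sets contain `K`
    -- and exceed it by little.
    have hdiff (w : X) (hw : K ⊆ jointVisits T U w) : μ.real (jointVisits T U w \ K) < ε / 2 := by
      rw [measureReal_sdiff hw hKm, measureReal_jointVisits_eq μ hU w x]
      linarith
    have hsub : symmDiff (jointVisits T U y) (jointVisits T U x) ⊆
        (jointVisits T U y \ K) ∪ (jointVisits T U x \ K) := by
      rintro w (⟨h1, h2⟩ | ⟨h1, h2⟩)
      · exact .inl ⟨h1, fun h ↦ h2 (hx.self_of_nhds h)⟩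
      · exact .inr ⟨h1, fun h ↦ h2 (hy h)⟩
    linarith [measureReal_mono (μ := μ) hsub, hdiff y hy, hdiff x hx.self_of_nhds,
      measureReal_union_le (μ := μ) (jointVisits T U y \ K) (jointVisits T U x \ K)]
  have comm (x y : X) : μ.real (symmDiff (jointVisits T U x) (jointVisits T U y)) =
      μ.real (symmDiff (jointVisits T U y) (jointVisits T U x)) := by
    rw [symmDiff_comm]
  refine ⟨continuous_of_triangle_of_tendsto comm tri near, fun _ _ ↦ measureReal_nonneg, by simp,
    comm, tri, fun t x y ↦ ?_⟩
  rw [jointVisits_smul, jointVisits_smul, ← Set.preimage_symmDiff, measureReal_def,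
    measure_preimage_smul, measureReal_def]

theorem inter_jointVisits_nonempty [CompactSpace X] [T2Space X] [μ.Regular] [NeZero μ]
    [MulAction.IsMinimal T X] {U : Set X} (hU : IsOpen U) (hne : U.Nonempty) {x y : X}
    (hxy : (pseudometricCon T X).toSetoid x y) {W : Set X} (hW : W ∈ 𝓝 y) :
    ∃ w ∈ W, w ∈ jointVisits T U x := by
  by_contra! hc
  have h0 := hxy _ (isInvariantPseudometric_jointVisits (T := T) μ hU)
  have hpos : 0 < μ (interior W ∩ jointVisits T U y) :=
    measure_isOpen_pos_of_smulInvariant_of_ne_zero T (NeZero.ne μ)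
      (isOpen_interior.inter (isOpen_jointVisits_left hU y))
      ⟨y, mem_interior_iff_mem_nhds.2 hW, self_mem_jointVisits hU hne y⟩
  rw [measureReal_eq_zero_iff] at h0
  exact hpos.ne' (measure_mono_null
    (fun w hw ↦ .inr ⟨hw.2, hc w (interior_subset hw.1)⟩) h0)

end Measure

/-! ### From pseudometrics to D and V. -/

section Main

variable {T X : Type*} [Group T] [TopologicalSpace X] [MulAction T X] [ContinuousConstSMul T X]
  [CompactSpace X] [T2Space X]

/-- The given Borel measure may fail to be regular; the regular measure with the same integrals of
continuous functions inherits invariance by uniqueness. -/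
theorem exists_regular_smulInvariantMeasure [MeasurableSpace X] [BorelSpace X] {μ : Measure X}
    [IsProbabilityMeasure μ] [SMulInvariantMeasure T X μ] :
    ∃ ν : Measure X, ν.Regular ∧ IsFiniteMeasure ν ∧ NeZero ν ∧ SMulInvariantMeasure T X ν := by
  obtain ⟨ν, _, _, hν⟩ := Measure.exists_regular_eq_of_compactSpace μ
  refine ⟨ν, ‹_›, ‹_›, ⟨?_⟩, ⟨fun t s hs ↦ ?_⟩⟩
  · rintro rfl
    simpa using hν 1
  · have hm : Measurable fun x : X ↦ t • x := (continuous_const_smul t).measurable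
    rw [← Measure.map_apply hm hs]
    have : (ν.map fun x ↦ t • x).Regular := Measure.Regular.map (Homeomorph.smul t)
    congr 1
    refine Measure.ext_of_integral_eq_on_compactlySupported fun f ↦ ?_
    have h1 := hν (.mkOfCompact ⟨f, f.continuous⟩)
    have h2 := hν (.mkOfCompact ⟨fun x ↦ f (t • x), f.continuous.comp (continuous_const_smul t)⟩)
    simp only [BoundedContinuousFunction.mkOfCompact_apply, ContinuousMap.coe_mk] at h1 h2
    refine ((Homeomorph.smul t).measurableEmbedding.integral_map f).trans ?_
    rw [← h1, ← integral_smul_eq_self (μ := μ) f (g := t), h2]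
    rfl

theorem exists_mem_jointVisits [MulAction.IsMinimal T X]
    (hμ : HasInvariantProbabilityMeasure T X) {U : Set X} (hU : IsOpen U) (hne : U.Nonempty)
    {x y : X} (hxy : (pseudometricCon T X).toSetoid x y) {W : Set X} (hW : W ∈ 𝓝 y) :
    ∃ w ∈ W, w ∈ jointVisits T U x := by
  let : MeasurableSpace X := borel X
  have : BorelSpace X := ⟨rfl⟩
  obtain ⟨μ, _, _⟩ := hμ
  obtain ⟨ν, _, _, _, _⟩ := exists_regular_smulInvariantMeasure (T := T) (μ := μ)
  exact inter_jointVisits_nonempty ν hU hne hxy hW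

theorem pseudometricCon_subset_veechD [MulAction.IsMinimal T X]
    (hμ : HasInvariantProbabilityMeasure T X) :
    {p : X × X | (pseudometricCon T X).toSetoid p.1 p.2} ⊆ veechD T X := by
  rintro ⟨x, y⟩ hxy
  refine mem_veechD_of_forall_nhds fun U hU W hW ↦ ?_
  obtain ⟨w, hw, b, hbx, hbw⟩ := exists_mem_jointVisits hμ isOpen_interior
    ⟨x, mem_interior_iff_mem_nhds.2 hU⟩ hxy (interior_mem_nhds.2 hW)
  -- `c • x` approximates `w`, so `a = b * c` works.
  obtain ⟨c, hcW, hcU⟩ := (isOpen_interior.inter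
    (isOpen_interior.preimage (continuous_const_smul b))).exists_smul_mem T x ⟨w, hw, hbw⟩
  exact ⟨b * c, b, by rw [mul_smul]; exact interior_subset hcU, interior_subset hbx,
    by rw [inv_mul_cancel_left]; exact interior_subset hcW⟩

theorem pseudometricCon_subset_veechV [MulAction.IsMinimal T X]
    [TopologicalSpace.MetrizableSpace X] (hμ : HasInvariantProbabilityMeasure T X) :
    {p : X × X | (pseudometricCon T X).toSetoid p.1 p.2} ⊆ veechV T X := by
  rintro ⟨x, y⟩ hxy
  let := TopologicalSpace.metrizableSpaceMetric X
  have : Nonempty X := ⟨x⟩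
  -- `E n` holds the `z` that witness V up to `1 / (n + 1)`; Baire gives one `z` for all `n`.
  let E : ℕ → Set X := fun n ↦ ⋃ t : T,
    Metric.ball (t • x) (1 / (n + 1)) ∩ (fun z ↦ t⁻¹ • z) ⁻¹' Metric.ball y (1 / (n + 1))
  have hEo (n : ℕ) : IsOpen (E n) := isOpen_iUnion fun t ↦
    Metric.isOpen_ball.inter (Metric.isOpen_ball.preimage (continuous_const_smul _))
  have hEd (n : ℕ) : Dense (E n) := by
    have hn : (0 : ℝ) < 1 / (n + 1) := by positivity
    refine Metric.dense_iff.2 fun z r hr ↦ ?_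
    -- The point of `E n` near `z` is `t • w`; the halved radius bounds its distance to `t • x`.
    obtain ⟨w, hw, t, htx, htw⟩ := exists_mem_jointVisits hμ
      (U := Metric.ball z (min r (1 / (n + 1) / 2))) Metric.isOpen_ball
      ⟨z, Metric.mem_ball_self (by positivity)⟩ hxy (Metric.ball_mem_nhds y hn)
    rw [Metric.mem_ball, lt_min_iff] at htx htw
    refine ⟨t • w, htw.1, Set.mem_iUnion.2 ⟨t, ?_, by simpa using hw⟩⟩
    rw [Metric.mem_ball]
    linarith [dist_triangle_right (t • w) (t • x) z, htx.2, htw.2]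
  obtain ⟨z, hz⟩ := (dense_iInter_of_isOpen hEo hEd).nonempty
  refine mem_veechV_of_forall_nhds (z := z) fun U hU W hW ↦ ?_
  obtain ⟨r, hr, hrU⟩ := Metric.mem_nhds_iff.1 hU
  obtain ⟨s, hs, hsW⟩ := Metric.mem_nhds_iff.1 hW
  obtain ⟨n, hn⟩ := exists_nat_one_div_lt (lt_min hr hs)
  rw [lt_min_iff] at hn
  obtain ⟨t, ht, ht'⟩ := Set.mem_iUnion.1 (Set.mem_iInter.1 hz n)
  rw [Metric.mem_ball'] at ht
  exact ⟨t, hrU (ht.trans hn.1), hsW (Metric.ball_subset_ball hn.2.le ht')⟩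

end Main

end TopFlow

theorem mainTheorem5 (T X : Type*)
    [Group T] [TopologicalSpace T] [IsTopologicalGroup T]
    [TopologicalSpace X] [CompactSpace X] [T2Space X]
    [MulAction T X] [ContinuousSMul T X] :
    TopFlow.veechD T X ⊆ TopFlow.regionallyProximal T X ∧
    (MulAction.IsMinimal T X → TopFlow.veechV T X ⊆ TopFlow.veechD T X) ∧
    (MulAction.IsMinimal T X → TopFlow.HasInvariantProbabilityMeasure T X →
      TopFlow.veechD T X = TopFlow.regionallyProximal T X ∧
      TopFlow.IsEquicontinuousStructureRelation T (TopFlow.veechD T X)) ∧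
    (MulAction.IsMinimal T X → TopologicalSpace.MetrizableSpace X →
      TopFlow.HasInvariantProbabilityMeasure T X →
      TopFlow.veechV T X = TopFlow.regionallyProximal T X ∧
      TopFlow.regionallyProximal T X = TopFlow.veechD T X) := by
  have hDR := TopFlow.veechD_subset_regionallyProximal (T := T) (X := X)
  have hRE := TopFlow.regionallyProximal_subset_pseudometricCon T X
  refine ⟨hDR, fun _ ↦ TopFlow.veechV_subset_veechD, fun _ hμ ↦ ?_, fun _ _ hμ ↦ ?_⟩
  · have hED := TopFlow.pseudometricCon_subset_veechD hμ
    refine ⟨hDR.antisymm (hRE.trans hED), ?_, fun R hR ↦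
      hDR.trans (TopFlow.regionallyProximal_subset_of_hasEquicontinuousQuotient hR)⟩
    rw [(hDR.trans hRE).antisymm hED]
    exact ⟨TopFlow.isClosed_pseudometricCon T X, TopFlow.pseudometricCon T X, rfl,
      TopFlow.isEquicontinuous_pseudometricCon_quotient⟩
  · exact ⟨(TopFlow.veechV_subset_veechD.trans hDR).antisymm
      (hRE.trans (TopFlow.pseudometricCon_subset_veechV hμ)),
      (hRE.trans (TopFlow.pseudometricCon_subset_veechD hμ)).antisymm hDR⟩
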